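/- Let $1<p<\infty$ and let $(X,d,\mu)$ be a complete metric space with a doubling Borel measure $\mu$ (balls have positive finite measure) supporting a $p$-Poincaré inequality. Let $\Omega\subset X$ be a bounded domain (non-empty, open, connected) of finite perimeter with $\mu(X\setminus\Omega)>0$, let $P_\Omega$ be its perimeter measure, and assume that for some $C\ge 1$, for all $x\in\partial\Omega$, $z\in\Omega$ and $0<r\le\operatorname{diam}\Omega$, $$\mu(B(z,r)\cap\Omega)\ge C^{-1}\mu(B(z,r)),\qquad C^{-1}\frac{\mu(B(x,r))}{r}\le P_\Omega(B(x,r))\le C\,\frac{\mu(B(x,r))}{r},$$ and that $\Omega$, with the restricted metric and measure, supports a $p$-Poincaré inequality with dilation factor $\lambda=1$. Here $P_\Omega$ is the Carathéodory extension of $$U\mapsto P_\Omega(U)=\inf\Bigl\{\liminf_{k\to\infty}\int_U g_{k}\,d\mu:\ u_k\in N^{1,1}(U),\ g_k \text{ an upper gradient of } u_k \text{ in } U,\ u_k\to\chi_{\Omega\cap U}\text{ in }L^1(U)\Bigr\},\quad U \text{ open}.$$ Let $f:\partial\Omega\to\mathbb R$ be continuous (hence bounded) with $\int_{\partial\Omega}f\,dP_\Omega=0$,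 and let $u:\Omega\to\mathbb R$ be a $p$-harmonic solution to the Neumann boundary value problem with boundary data $f$; that is, $u$ belongs to the Newtonian space $N^{1,p}(\Omega)$ (functions in $L^p(\Omega)$, defined everywhere, with an upper gradient in $L^p(\Omega)$) and $$I(u)=\int_\Omega g_u^p\,d\mu+\int_{\partial\Omega}Tu\,f\,dP_\Omega\ \le\ \int_\Omega g_v^p\,d\mu+\int_{\partial\Omega}Tv\,f\,dP_\Omega=I(v)\qquad\text{for every } v\in N^{1,p}(\Omega),$$ where $g_v$ is the minimal $p$-weak upper gradient of $v$ in $\Omega$, and $Tv$ is the trace of $v$, characterized by $\lim_{r\to0^+}\frac{1}{\mu(B(x,r)\cap\Omega)}\int_{B(x,r)\cap\Omega}|v-Tv(x)|\,d\mu=0$ for almost every $x\in\partial\Omega$ with respect to the co-dimension $1$ Hausdorff measure. (i) If $x\in\partial\Omega$ and $r>0$ are such that $u$ is constant on $B(x,r)\cap\Omega$, then $f=0$ on $B(x,r/2)\cap\partial\Omega$. (ii) Consequently, if $f$ is not identically $0$ on $\partial\Omega$, then $u$ is not constant on $\Omega$. -/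

import Mathlib

open MeasureTheory Filter Set Metric
open scoped ENNReal NNReal Topology

noncomputable section

namespace NeumannMetric

/-! ### Curves, upper gradients and Newtonian spaces

Functions on a subset `A` of the ambient space `X` are represented by functions on `X`, of which
only the values on `A` matter. The subset `A` is regarded as a metric measure space of its own, with
the restricted metric and the measure `μ.restrict A`. It is an open set wherever this is used. -/

/-- A nonconstant compact rectifiable curve, parametrized by arc length on `[0, len]`. (Only the
values of `toFun` on `[0, len]` matter.) -/
structure RectCurve (X : Type*) [PseudoEMetricSpace X] where
  /-- the length of the curve -/
  len : ℝ
  len_pos : 0 < len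
  /-- the arc length parametrization -/
  toFun : ℝ → X
  unitSpeed : HasUnitSpeedOn toFun (Icc 0 len)

section Basic

variable {X : Type*} [MetricSpace X]

/-- The curve runs inside `A`. -/
def RectCurve.InSet (γ : RectCurve X) (A : Set X) : Prop :=
  ∀ t ∈ Icc 0 γ.len, γ.toFun t ∈ A

/-- The line integral `∫_γ g ds`. -/
def RectCurve.lineIntegral (γ : RectCurve X) (g : X → ℝ≥0∞) : ℝ≥0∞ :=
  ∫⁻ t in Icc 0 γ.len, g (γ.toFun t)

/-- The upper gradient inequality `|u(y) - u(x)| ≤ ∫_γ g ds` along `γ`, for `x`, `y` the end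
points of `γ`. -/
def UGInequality (u : X → ℝ) (g : X → ℝ≥0∞) (γ : RectCurve X) : Prop :=
  ENNReal.ofReal |u (γ.toFun γ.len) - u (γ.toFun 0)| ≤ γ.lineIntegral g

variable [MeasurableSpace X]

/-- The Borel function `g` is an upper gradient of `u` in `A`. (For constant curves the inequality
is trivial, as `u` is finite.) -/
def IsUpperGradientOn (A : Set X) (u : X → ℝ) (g : X → ℝ≥0∞) : Prop :=
  Measurable g ∧ ∀ γ : RectCurve X, γ.InSet A → UGInequality u g γ

/-- The `p`-modulus of a family `Γ` of curves in the metric measure space `A`. -/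
def curveModulus (μ : Measure X) (A : Set X) (p : ℝ) (Γ : Set (RectCurve X)) : ℝ≥0∞ :=
  ⨅ (ρ : X → ℝ≥0∞) (_ : Measurable ρ) (_ : ∀ γ ∈ Γ, 1 ≤ γ.lineIntegral ρ),
    ∫⁻ x in A, ρ x ^ p ∂μ

/-- The Borel function `g` is a `p`-weak upper gradient of `u` in `A`: the upper gradient
inequality holds along `p`-almost every curve in `A`. -/
def IsWeakUpperGradientOn (μ : Measure X) (A : Set X) (p : ℝ) (u : X → ℝ) (g : X → ℝ≥0∞) :
    Prop :=
  Measurable g ∧ curveModulus μ A p {γ | γ.InSet A ∧ ¬ UGInequality u g γ} = 0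

/-- `g` is a (representative of the) minimal `p`-weak upper gradient `g_u` of `u` in `A`: among the
`p`-integrable `p`-weak upper gradients it is the smallest one almost everywhere. -/
def IsMinimalWeakUpperGradientOn (μ : Measure X) (A : Set X) (p : ℝ) (u : X → ℝ)
    (g : X → ℝ≥0∞) : Prop :=
  IsWeakUpperGradientOn μ A p u g ∧ ∫⁻ x in A, g x ^ p ∂μ < ∞ ∧
    ∀ h : X → ℝ≥0∞, IsWeakUpperGradientOn μ A p u h → ∫⁻ x in A, h x ^ p ∂μ < ∞ →
      ∀ᵐ x ∂μ.restrict A, g x ≤ h x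

/-- `u` belongs to the Newtonian space `N^{1,p}(A)`: it is in `L^p(A)` and has an upper gradient
in `L^p(A)`. Functions are defined everywhere, not up to null sets. -/
def MemNewtonian (μ : Measure X) (A : Set X) (p : ℝ) (u : X → ℝ) : Prop :=
  MemLp u (ENNReal.ofReal p) (μ.restrict A) ∧
    ∃ g : X → ℝ≥0∞, IsUpperGradientOn A u g ∧ ∫⁻ x in A, g x ^ p ∂μ < ∞

/-- The measure `μ` is doubling (and balls have positive and finite measure). -/
def IsDoublingMeasure (μ : Measure X) : Prop :=
  ∃ C : ℝ≥0, ∀ (x : X) (r : ℝ), 0 < r →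
    0 < μ (ball x (2 * r)) ∧ μ (ball x (2 * r)) ≤ C * μ (ball x r) ∧ μ (ball x r) < ∞

/-- The metric measure space `A` supports a `p`-Poincaré inequality with dilation factor `lam`. The
balls of `A` are the sets `ball z r ∩ A` with `z ∈ A`; the inequality is required of all `u` that are
integrable on bounded subsets of `A` and all upper gradients `g` of `u` in `A`. -/
def SupportsPoincareWith (μ : Measure X) (A : Set X) (p lam : ℝ) : Prop :=
  ∃ C : ℝ≥0, ∀ (u : X → ℝ) (g : X → ℝ≥0∞),
    (∀ z ∈ A, ∀ r : ℝ, IntegrableOn u (ball z r ∩ A) μ) → IsUpperGradientOn A u g →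
    ∀ z ∈ A, ∀ r : ℝ, 0 < r →
      ⨍⁻ y in ball z r ∩ A, ENNReal.ofReal |u y - ⨍ w in ball z r ∩ A, u w ∂μ| ∂μ ≤
        C * ENNReal.ofReal r * (⨍⁻ y in ball z (lam * r) ∩ A, g y ^ p ∂μ) ^ (1 / p)

/-- The metric measure space `A` supports a `p`-Poincaré inequality, with some dilation factor. -/
def SupportsPoincare (μ : Measure X) (A : Set X) (p : ℝ) : Prop :=
  ∃ lam : ℝ, 0 < lam ∧ SupportsPoincareWith μ A p lam

/-! ### Sets of finite perimeter -/

/-- The sequences `(u_k, g_k)` admissible for the perimeter of `E` in the open set `U`: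
`u_k ∈ N^{1,1}(U)` tends to the characteristic function of `E` in `L^1(U)`, and `g_k` is an upper
gradient of `u_k` in `U`. -/
def IsPerimeterSeq (μ : Measure X) (E U : Set X) (u : ℕ → X → ℝ) (g : ℕ → X → ℝ≥0∞) : Prop :=
  (∀ k, MemNewtonian μ U 1 (u k)) ∧ (∀ k, IsUpperGradientOn U (u k) (g k)) ∧
    Tendsto (fun k => ∫⁻ x in U, ENNReal.ofReal |u k x - E.indicator (fun _ => (1 : ℝ)) x| ∂μ)
      atTop (𝓝 0)

/-- The perimeter `P_E(U)` of `E` in the open set `U`, the infimum of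
`liminf_k ∫_U g_k dμ` over all admissible sequences. -/
def perimeterOn (μ : Measure X) (E U : Set X) : ℝ≥0∞ :=
  ⨅ (u : ℕ → X → ℝ) (g : ℕ → X → ℝ≥0∞) (_ : IsPerimeterSeq μ E U u g),
    liminf (fun k => ∫⁻ x in U, g k x ∂μ) atTop

/-- `E` is a Borel set of finite perimeter. -/
def HasFinitePerimeter (μ : Measure X) (E : Set X) : Prop :=
  MeasurableSet E ∧ perimeterOn μ E univ < ∞

theorem IsPerimeterSeq.mono {μ : Measure X} {E U V : Set X} {u : ℕ → X → ℝ}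
    {g : ℕ → X → ℝ≥0∞} (h : IsPerimeterSeq μ E U u g) (hVU : V ⊆ U) :
    IsPerimeterSeq μ E V u g := by
  obtain ⟨h1, h2, h3⟩ := h
  have hug : ∀ (w : X → ℝ) (q : X → ℝ≥0∞), IsUpperGradientOn U w q → IsUpperGradientOn V w q :=
    fun w q hq => ⟨hq.1, fun γ hγ => hq.2 γ fun t ht => hVU (hγ t ht)⟩
  refine ⟨fun k => ?_, fun k => hug _ _ (h2 k), ?_⟩
  · obtain ⟨hL, q, hq, hfin⟩ := h1 k
    exact ⟨hL.mono_measure (Measure.restrict_mono_set μ hVU), q, hug _ _ hq,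
      (lintegral_mono_set hVU).trans_lt hfin⟩
  · exact tendsto_of_tendsto_of_tendsto_of_le_of_le tendsto_const_nhds h3
      (fun _ => zero_le) (fun _ => lintegral_mono_set hVU)

theorem perimeterOn_le {μ : Measure X} {E U : Set X} {u : ℕ → X → ℝ} {g : ℕ → X → ℝ≥0∞}
    (h : IsPerimeterSeq μ E U u g) :
    perimeterOn μ E U ≤ liminf (fun k => ∫⁻ x in U, g k x ∂μ) atTop :=
  (iInf_le _ u).trans ((iInf_le _ g).trans (iInf_le _ h))

theorem perimeterOn_mono (μ : Measure X) (E : Set X) {U V : Set X} (hVU : V ⊆ U) :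
    perimeterOn μ E V ≤ perimeterOn μ E U := by
  refine le_iInf fun u => le_iInf fun g => le_iInf fun h => ?_
  refine (perimeterOn_le (h.mono hVU)).trans ?_
  exact liminf_le_liminf (Eventually.of_forall fun k => lintegral_mono_set hVU)

theorem perimeterOn_empty (μ : Measure X) (E : Set X) : perimeterOn μ E ∅ = 0 := by
  refine le_antisymm ?_ zero_le
  have h : IsPerimeterSeq μ E ∅ (fun _ _ => 0) (fun _ _ => 0) := by
    have hug : IsUpperGradientOn (∅ : Set X) (fun _ => 0) (fun _ => 0) :=
      ⟨measurable_const, fun γ _ => by simp [UGInequality]⟩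
    refine ⟨fun _ => ⟨by simp, _, hug, by simp⟩, fun _ => hug, by simp⟩
  refine (perimeterOn_le h).trans ?_
  simp

theorem perimeterOn_add_le (μ : Measure X) (E : Set X) {U V W : Set X} [OpensMeasurableSpace X]
    (hV : V ⊆ U) (hW : W ⊆ U) (hWo : IsOpen W) (hd : Disjoint V W) :
    perimeterOn μ E V + perimeterOn μ E W ≤ perimeterOn μ E U := by
  refine le_iInf fun u => le_iInf fun g => le_iInf fun h => ?_
  refine (add_le_add (perimeterOn_le (h.mono hV)) (perimeterOn_le (h.mono hW))).trans ?_
  rw [liminf_eq_iSup_iInf_of_nat, liminf_eq_iSup_iInf_of_nat, ENNReal.iSup_add_iSup_of_monotone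
    (fun m n hmn => biInf_mono fun i hi => le_trans hmn hi)
    (fun m n hmn => biInf_mono fun i hi => le_trans hmn hi), liminf_eq_iSup_iInf_of_nat]
  refine iSup_mono fun n => le_iInf fun i => le_iInf fun hi => ?_
  refine (add_le_add (iInf₂_le i hi) (iInf₂_le i hi)).trans ?_
  rw [← lintegral_union hWo.measurableSet hd]
  exact lintegral_mono_set (union_subset hV hW)

/-- The outer measure on all subsets of `X` that is generated by the perimeters `P_E(U)` of `E` in
open sets `U`. -/
def perimeterOuterMeasure (μ : Measure X) (E : Set X) : OuterMeasure X :=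
  inducedOuterMeasure (fun (U : Set X) (_ : IsOpen U) => perimeterOn μ E U) isOpen_empty
    (perimeterOn_empty μ E)

theorem perimeterOuterMeasure_isMetric (μ : Measure X) (E : Set X) [OpensMeasurableSpace X] :
    (perimeterOuterMeasure μ E).IsMetric := by
  rintro s t ⟨r, hr0, hr⟩
  refine le_antisymm (measure_union_le _ _) ?_
  unfold perimeterOuterMeasure inducedOuterMeasure
  rw [OuterMeasure.ofFunction_eq_iInf_mem (P := IsOpen)
    (m_top := fun s hs => extend_eq_top _ hs) (s := s ∪ t)]
  refine le_iInf fun f => le_iInf fun hfo => le_iInf fun hf => ?_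
  obtain ⟨ε, hε0, hεr⟩ : ∃ ε : ℝ≥0∞, 0 < ε ∧ ε + ε ≤ r :=
    ⟨r / 2, ENNReal.half_pos hr0, by rw [ENNReal.add_halves]⟩
  set N : Set X → Set X := fun a => ⋃ x ∈ a, Metric.eball x ε with hN
  have hNo : ∀ a, IsOpen (N a) := fun a =>
    isOpen_biUnion fun x _ => Metric.isOpen_eball
  have hsub : ∀ a : Set X, a ⊆ N a := fun a x hx =>
    mem_biUnion hx (Metric.mem_eball_self hε0)
  have hdis : Disjoint (N s) (N t) := by
    rw [Set.disjoint_left]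
    intro z hz hz'
    simp only [hN, mem_iUnion, Metric.mem_eball, exists_prop] at hz hz'
    obtain ⟨x, hx, hzx⟩ := hz
    obtain ⟨y, hy, hzy⟩ := hz'
    have h1 : edist x y < ε + ε :=
      (edist_triangle_left x y z).trans_lt (ENNReal.add_lt_add hzx hzy)
    exact absurd (hr x hx y hy) (not_le.2 (h1.trans_le hεr))
  have key : ∀ a, a ⊆ s ∪ t → OuterMeasure.ofFunction (extend fun (U : Set X) (_ : IsOpen U) =>
      perimeterOn μ E U) (extend_empty isOpen_empty (perimeterOn_empty μ E)) a ≤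
      ∑' i, perimeterOn μ E (f i ∩ N a) := by
    intro a ha
    rw [OuterMeasure.ofFunction_apply]
    refine iInf_le_of_le (fun i => f i ∩ N a) (iInf_le_of_le ?_ ?_)
    · rw [← iUnion_inter]
      exact subset_inter (ha.trans hf) (hsub a)
    · exact le_of_eq (tsum_congr fun i => extend_eq _ ((hfo i).inter (hNo a)))
  refine (add_le_add (key s subset_union_left) (key t subset_union_right)).trans ?_
  rw [← ENNReal.tsum_add]
  refine ENNReal.tsum_le_tsum fun i => ?_
  rw [extend_eq _ (hfo i)]
  exact perimeterOn_add_le μ E inter_subset_left inter_subset_left ((hfo i).inter (hNo t))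
    (hdis.mono inter_subset_right inter_subset_right)

/-- The perimeter measure `P_E`, the Carathéodory extension of `U ↦ P_E(U)` to the Borel sets. -/
def perimeterMeasure [BorelSpace X] (μ : Measure X) (E : Set X) : Measure X :=
  (perimeterOuterMeasure μ E).toMeasure (perimeterOuterMeasure_isMetric μ E).le_caratheodory

/-- The co-dimension `1` Hausdorff measure: the limit as `δ → 0⁺` (a supremum, by monotonicity) of
the infimum of `∑ μ(B_i) / rad(B_i)` over countable coverings by balls of radii `< δ`. A ball is
recorded as the pair of its centre and its radius. -/
def codimHausdorff (μ : Measure X) (A : Set X) : ℝ≥0∞ :=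
  ⨆ (δ : ℝ) (_ : 0 < δ), ⨅ (S : Set (X × ℝ)) (_ : S.Countable)
    (_ : ∀ b ∈ S, 0 < b.2 ∧ b.2 < δ) (_ : A ⊆ ⋃ b ∈ S, ball b.1 b.2),
      ∑' b : S, μ (ball b.1.1 b.1.2) / ENNReal.ofReal b.1.2

end Basic

/-! ### The Neumann problem -/

section Neumann

variable {X : Type*} [MetricSpace X] [MeasurableSpace X] [BorelSpace X]

/-- The standing assumptions on the domain `Ω`. -/
structure IsAdmissibleDomain (μ : Measure X) (p : ℝ) (Ω : Set X) : Prop where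
  isOpen : IsOpen Ω
  isConnected : IsConnected Ω
  isBounded : Bornology.IsBounded Ω
  compl_pos : 0 < μ Ωᶜ
  finitePerimeter : HasFinitePerimeter μ Ω
  density : ∃ C : ℝ≥0, ∀ z ∈ Ω, ∀ r : ℝ, 0 < r → r ≤ diam Ω →
    μ (ball z r) ≤ C * μ (ball z r ∩ Ω)
  /-- Ahlfors codimension `1` regularity of the perimeter measure -/
  boundary : ∃ C : ℝ≥0, ∀ x ∈ frontier Ω, ∀ r : ℝ, 0 < r → r ≤ diam Ω →
    μ (ball x r) / ENNReal.ofReal r ≤ C * perimeterMeasure μ Ω (ball x r) ∧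
    perimeterMeasure μ Ω (ball x r) ≤ C * (μ (ball x r) / ENNReal.ofReal r)
  poincare : SupportsPoincareWith μ Ω p 1

/-- `Tu` is a trace of `u` on `∂Ω`: for almost every `x ∈ ∂Ω` with respect to the co-dimension `1`
Hausdorff measure, the mean values of `|u - Tu(x)|` over `B(x,r) ∩ Ω` tend to `0` as `r → 0⁺`. -/
def IsTrace (μ : Measure X) (Ω : Set X) (u Tu : X → ℝ) : Prop :=
  codimHausdorff μ {x ∈ frontier Ω | ¬ Tendsto
    (fun r : ℝ => ⨍⁻ y in ball x r ∩ Ω, ENNReal.ofReal |u y - Tu x| ∂μ) (𝓝[>] 0) (𝓝 0)} = 0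

/-- Admissible boundary data: bounded, `P_Ω`-measurable and of integral `0` on `∂Ω`. -/
structure IsNeumannData (μ : Measure X) (Ω : Set X) (f : X → ℝ) : Prop where
  bounded : ∃ M : ℝ, ∀ x ∈ frontier Ω, |f x| ≤ M
  aemeasurable : AEMeasurable f ((perimeterMeasure μ Ω).restrict (frontier Ω))
  integral_eq_zero : ∫ x in frontier Ω, f x ∂(perimeterMeasure μ Ω) = 0

/-- The functional `I` is well defined at `u`, with the value
`I(u) = ∫_Ω g_u^p dμ + ∫_{∂Ω} Tu f dP_Ω = e`. -/
def HasNeumannEnergy (μ : Measure X) (p : ℝ) (Ω : Set X) (f u : X → ℝ) (e : ℝ) : Prop :=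
  ∃ (g : X → ℝ≥0∞) (Tu : X → ℝ), IsMinimalWeakUpperGradientOn μ Ω p u g ∧ IsTrace μ Ω u Tu ∧
    IntegrableOn (fun x => Tu x * f x) (frontier Ω) (perimeterMeasure μ Ω) ∧
    e = (∫⁻ x in Ω, g x ^ p ∂μ).toReal + ∫ x in frontier Ω, Tu x * f x ∂(perimeterMeasure μ Ω)

/-- `u` is a `p`-harmonic solution to the Neumann boundary value problem on `Ω` with boundary
data `f`: `u ∈ N^{1,p}(Ω)` and `I(u) ≤ I(v)` for every `v ∈ N^{1,p}(Ω)`. -/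
def IsNeumannSolution (μ : Measure X) (p : ℝ) (Ω : Set X) (f u : X → ℝ) : Prop :=
  IsNeumannData μ Ω f ∧ MemNewtonian μ Ω p u ∧
    ∃ e : ℝ, HasNeumannEnergy μ p Ω f u e ∧
      ∀ v : X → ℝ, MemNewtonian μ Ω p v → ∀ e' : ℝ, HasNeumannEnergy μ p Ω f v e' → e ≤ e'

end Neumann

end NeumannMetric

end

open NeumannMetric

noncomputable section

namespace NeumannMetric

/-! ### Functions on an interval whose increments are dominated by an integral -/

section Interval

variable {F : ℝ → ℝ} {g : ℝ → ℝ≥0∞} {L : ℝ}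

/-! Perturb `u` by `τ * φ`, with `φ` Lipschitz and supported well inside a ball on which `u` is
constant. On that ball only `τ * φ` has a gradient, of size at most `|τ| * K`; elsewhere the
gradient of `u` is untouched. So the energy term grows by at most a multiple of `|τ| ^ p`, while the
boundary term changes by exactly `τ * ∫ φ f dP_Ω`. As `p > 1`, minimality for both signs of `τ`
forces `∫ φ f dP_Ω = 0` (`IsNeumannSolution.setIntegral_mul_eq_zero`).

If `f y ≠ 0` at a boundary point `y` inside the ball, then `f` has the sign of `f y` near `y`. A
tent function `φ` centred at `y` then gives `P_Ω (ball y s) = 0`, since `P_Ω` lives on the boundary.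
This contradicts the lower codimension 1 bound (`IsNeumannSolution.eq_zero_of_eqOn_ball`).

The technical work is to show that the perturbation is an admissible competitor with finite energy.
The weak upper gradient condition is turned into a pointwise one: along `p`-almost every curve, `u ∘
γ` is absolutely continuous with derivative bounded a.e. by `g ∘ γ`. In this form gradients can be
glued and countable infima taken, which yields the gradient of the perturbation and the existence of
minimal weak upper gradients. -/

theorem exists_real_primitive_bound (hg : AEMeasurable g (volume.restrict (Icc 0 L)))
    (hfin : ∫⁻ t in Icc 0 L, g t ≠ ∞)
    (hF : ∀ a b, 0 ≤ a → a < b → b ≤ L → ENNReal.ofReal |F b - F a| ≤ ∫⁻ t in Icc a b, g t)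
    (hL : 0 ≤ L) :
    IntervalIntegrable (fun t => (g t).toReal) volume 0 L ∧
      ∀ a ∈ uIcc 0 L, ∀ b ∈ uIcc 0 L, dist (F a) (F b) ≤
        dist (∫ t in (0 : ℝ)..a, (g t).toReal) (∫ t in (0 : ℝ)..b, (g t).toReal) := by
  have hint : IntegrableOn (fun t => (g t).toReal) (Icc 0 L) :=
    integrable_toReal_of_lintegral_ne_top hg hfin
  have hii : ∀ a ∈ Icc 0 L, ∀ b ∈ Icc 0 L,
      IntervalIntegrable (fun t => (g t).toReal) volume a b := fun a ha b hb =>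
    (hint.mono_set (uIcc_subset_Icc ha hb)).intervalIntegrable
  have key : ∀ a ∈ Icc 0 L, ∀ b ∈ Icc 0 L, a < b → dist (F a) (F b) ≤
      dist (∫ t in (0 : ℝ)..a, (g t).toReal) (∫ t in (0 : ℝ)..b, (g t).toReal) := by
    intro a ha b hb hab
    have hsub : Icc a b ⊆ Icc 0 L := Icc_subset_Icc ha.1 hb.2
    have hfin' : ∫⁻ t in Icc a b, g t ≠ ∞ :=
      ne_top_of_le_ne_top hfin (lintegral_mono_set hsub)
    have h0 : (0 : ℝ) ∈ Icc 0 L := ⟨le_rfl, hL⟩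
    rw [dist_comm, dist_comm (∫ t in (0 : ℝ)..a, (g t).toReal), Real.dist_eq, Real.dist_eq,
      intervalIntegral.integral_interval_sub_left (hii 0 h0 b hb) (hii 0 h0 a ha),
      intervalIntegral.integral_of_le hab.le, ← integral_Icc_eq_integral_Ioc,
      integral_toReal (hg.mono_measure (Measure.restrict_mono_set _ hsub))
        (ae_lt_top' (hg.mono_measure (Measure.restrict_mono_set _ hsub)) hfin'),
      abs_of_nonneg (a := ENNReal.toReal _) ENNReal.toReal_nonneg]
    exact (ENNReal.ofReal_le_iff_le_toReal hfin').1 (hF a b ha.1 hab hb.2)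
  refine ⟨hii 0 ⟨le_rfl, hL⟩ L ⟨hL, le_rfl⟩, fun a ha b hb => ?_⟩
  rw [uIcc_of_le hL] at ha hb
  rcases lt_trichotomy a b with h | h | h
  · exact key a ha b hb h
  · simp [h]
  · rw [dist_comm, dist_comm (∫ t in (0 : ℝ)..a, (g t).toReal)]
    exact key b hb a ha h

/-- Increments of `F` are dominated by those of the primitive of `g`, which is absolutely
continuous. -/
theorem absolutelyContinuousOnInterval_of_le_lintegral
    (hg : AEMeasurable g (volume.restrict (Icc 0 L)))
    (hfin : ∫⁻ t in Icc 0 L, g t ≠ ∞)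
    (hF : ∀ a b, 0 ≤ a → a < b → b ≤ L → ENNReal.ofReal |F b - F a| ≤ ∫⁻ t in Icc a b, g t)
    (hL : 0 ≤ L) : AbsolutelyContinuousOnInterval F 0 L := by
  obtain ⟨hi, hd⟩ := exists_real_primitive_bound hg hfin hF hL
  have hK := hi.absolutelyContinuousOnInterval_intervalIntegral (c := 0) left_mem_uIcc
  rw [absolutelyContinuousOnInterval_iff] at hK ⊢
  intro ε hε
  obtain ⟨δ, hδ, h⟩ := hK ε hε
  refine ⟨δ, hδ, fun E hE hEδ => (Finset.sum_le_sum fun i hi => ?_).trans_lt (h E hE hEδ)⟩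
  exact hd _ (hE.1 i hi).1 _ (hE.1 i hi).2

/-- Difference quotients of `F` are dominated by those of the primitive of `g`, whose derivative is
`g` a.e. by Lebesgue differentiation. -/
theorem ae_ofReal_abs_deriv_le (hg : AEMeasurable g (volume.restrict (Icc 0 L)))
    (hfin : ∫⁻ t in Icc 0 L, g t ≠ ∞)
    (hF : ∀ a b, 0 ≤ a → a < b → b ≤ L → ENNReal.ofReal |F b - F a| ≤ ∫⁻ t in Icc a b, g t)
    (hL : 0 ≤ L) : ∀ᵐ t, t ∈ Ioo 0 L → ENNReal.ofReal |deriv F t| ≤ g t := by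
  obtain ⟨hi, hd⟩ := exists_real_primitive_bound hg hfin hF hL
  have hAC := absolutelyContinuousOnInterval_of_le_lintegral hg hfin hF hL
  filter_upwards [hAC.ae_differentiableAt, hi.ae_hasDerivAt_integral] with x h1 h2 hx
  have hx' : x ∈ uIcc 0 L := by rw [uIcc_of_le hL]; exact Ioo_subset_Icc_self hx
  have hFs := (hasDerivAt_iff_tendsto_slope.1 (h1 hx').hasDerivAt).norm
  have hKs := (hasDerivAt_iff_tendsto_slope.1 (h2 hx' 0 left_mem_uIcc)).norm
  have hle : |deriv F x| ≤ ‖(g x).toReal‖ := by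
    refine le_of_tendsto_of_tendsto hFs hKs ?_
    have hev : ∀ᶠ y in 𝓝[≠] x, y ∈ Ioo 0 L := nhdsWithin_le_nhds (Ioo_mem_nhds hx.1 hx.2)
    filter_upwards [hev] with y hy
    have hy' : y ∈ uIcc 0 L := by rw [uIcc_of_le hL]; exact Ioo_subset_Icc_self hy
    rw [slope, slope, norm_smul, norm_smul]
    refine mul_le_mul_of_nonneg_left ?_ (norm_nonneg _)
    simpa [dist_eq_norm] using hd y hy' x hx'
  rw [Real.norm_of_nonneg ENNReal.toReal_nonneg] at hle
  exact (ENNReal.ofReal_le_ofReal hle).trans ENNReal.ofReal_toReal_le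

/-- The converse direction, by the fundamental theorem of calculus for absolutely continuous
functions; it returns from pointwise derivative bounds to the upper gradient inequality. -/
theorem ofReal_abs_sub_le_lintegral_of_deriv_le (hL : 0 ≤ L)
    (hAC : AbsolutelyContinuousOnInterval F 0 L)
    (hd : ∀ᵐ t, t ∈ Ioo 0 L → ENNReal.ofReal |deriv F t| ≤ g t) :
    ENNReal.ofReal |F L - F 0| ≤ ∫⁻ t in Icc 0 L, g t := by
  rw [← hAC.integral_deriv_eq_sub, intervalIntegral.integral_of_le hL,
    integral_Ioc_eq_integral_Ioo, ← Real.norm_eq_abs, ofReal_norm]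
  refine (enorm_integral_le_lintegral_enorm _).trans ?_
  refine le_trans ?_ (lintegral_mono_set Ioo_subset_Icc_self)
  refine lintegral_mono_ae ?_
  rw [ae_restrict_iff' measurableSet_Ioo]
  filter_upwards [hd] with t ht hmem
  rw [← ofReal_norm]
  exact ht hmem

end Interval

/-! ### Subcurves and exceptional families of curves -/

section Curves

variable {X : Type*} [MetricSpace X]

theorem RectCurve.lipschitzOnWith (γ : RectCurve X) :
    LipschitzOnWith 1 γ.toFun (Icc 0 γ.len) := by
  have key : ∀ a ∈ Icc 0 γ.len, ∀ b ∈ Icc 0 γ.len, a ≤ b →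
      dist (γ.toFun a) (γ.toFun b) ≤ b - a := by
    intro a ha b hb hab
    have h := eVariationOn.edist_le γ.toFun (s := Icc 0 γ.len ∩ Icc a b)
      ⟨ha, le_rfl, hab⟩ ⟨hb, hab, le_rfl⟩
    rw [γ.unitSpeed ha hb, edist_dist, NNReal.coe_one, one_mul] at h
    exact (ENNReal.ofReal_le_ofReal_iff (sub_nonneg.2 hab)).1 h
  refine LipschitzOnWith.of_dist_le_mul fun a ha b hb => ?_
  rw [NNReal.coe_one, one_mul, Real.dist_eq]
  rcases le_total a b with h | h
  · rw [abs_sub_comm]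
    exact (key a ha b hb h).trans (le_abs_self _)
  · rw [dist_comm]
    exact (key b hb a ha h).trans (le_abs_self _)

theorem RectCurve.abs_sub_le_mul_len (γ : RectCurve X) {φ : X → ℝ} {K : ℝ≥0}
    (hφ : LipschitzWith K φ) :
    |φ (γ.toFun γ.len) - φ (γ.toFun 0)| ≤ K * γ.len := by
  have h0 : (0 : ℝ) ∈ Icc 0 γ.len := ⟨le_rfl, γ.len_pos.le⟩
  have h1 : γ.len ∈ Icc 0 γ.len := ⟨γ.len_pos.le, le_rfl⟩
  have h2 := γ.lipschitzOnWith.dist_le_mul _ h1 _ h0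
  have h3 := hφ.dist_le_mul (γ.toFun γ.len) (γ.toFun 0)
  rw [NNReal.coe_one, one_mul, Real.dist_eq, sub_zero, abs_of_pos γ.len_pos] at h2
  exact h3.trans (mul_le_mul_of_nonneg_left h2 K.2)

theorem RectCurve.aemeasurable_comp [MeasurableSpace X] [BorelSpace X] (γ : RectCurve X)
    {g : X → ℝ≥0∞} (hg : Measurable g) :
    AEMeasurable (fun t => g (γ.toFun t)) (volume.restrict (Icc 0 γ.len)) :=
  hg.comp_aemeasurable (γ.lipschitzOnWith.continuousOn.aemeasurable measurableSet_Icc)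

/-- The subcurve `γ|[a, b]`, reparametrized on `[0, b - a]`. -/
def RectCurve.sub (γ : RectCurve X) {a b : ℝ} (ha : 0 ≤ a) (hab : a < b) (hb : b ≤ γ.len) :
    RectCurve X where
  len := b - a
  len_pos := sub_pos.2 hab
  toFun := fun t => γ.toFun (a + t)
  unitSpeed := by
    rw [HasUnitSpeedOn, hasConstantSpeedOnWith_iff_ordered]
    intro x hx y hy hxy
    have e1 : Icc 0 (b - a) ∩ Icc x y = Icc x y :=
      inter_eq_right.2 (Icc_subset_Icc hx.1 hy.2)
    have hx' : a + x ∈ Icc 0 γ.len := ⟨by linarith [hx.1], by linarith [hx.2]⟩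
    have hy' : a + y ∈ Icc 0 γ.len := ⟨by linarith [hy.1], by linarith [hy.2]⟩
    have e2 : Icc 0 γ.len ∩ Icc (a + x) (a + y) = Icc (a + x) (a + y) :=
      inter_eq_right.2 (Icc_subset_Icc hx'.1 hy'.2)
    have h := γ.unitSpeed hx' hy'
    rw [e2] at h
    rw [e1]
    have h3 := eVariationOn.comp_eq_of_monotoneOn γ.toFun (t := Icc x y) (fun t => a + t)
      (fun s _ t _ hst => by simpa using hst)
    rw [image_const_add_Icc] at h3
    rw [show (fun t => γ.toFun (a + t)) = γ.toFun ∘ fun t => a + t from rfl, h3, h]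
    congr 2
    ring

theorem RectCurve.InSet.sub {γ : RectCurve X} {A : Set X} (h : γ.InSet A) {a b : ℝ}
    (ha : 0 ≤ a) (hab : a < b) (hb : b ≤ γ.len) : (γ.sub ha hab hb).InSet A := by
  intro t ht
  have ht' : t ∈ Icc 0 (b - a) := ht
  exact h _ ⟨by linarith [ht'.1], by linarith [ht'.2]⟩

theorem RectCurve.lineIntegral_sub (γ : RectCurve X) (g : X → ℝ≥0∞) {a b : ℝ}
    (ha : 0 ≤ a) (hab : a < b) (hb : b ≤ γ.len) :
    (γ.sub ha hab hb).lineIntegral g = ∫⁻ t in Icc a b, g (γ.toFun t) := by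
  have h := (measurePreserving_add_left (volume : Measure ℝ) a).setLIntegral_comp_preimage_emb
    (measurableEmbedding_addLeft a) (fun t => g (γ.toFun t)) (Icc a b)
  rw [preimage_const_add_Icc, sub_self] at h
  exact h

/-- The upper gradient inequality holds along `γ` and all its subcurves, and `∫_γ g ds < ∞`. -/
def UGAlong (u : X → ℝ) (g : X → ℝ≥0∞) (γ : RectCurve X) : Prop :=
  γ.lineIntegral g ≠ ∞ ∧ ∀ a b, 0 ≤ a → a < b → b ≤ γ.len →
    ENNReal.ofReal |u (γ.toFun b) - u (γ.toFun a)| ≤ ∫⁻ t in Icc a b, g (γ.toFun t)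

section UGAlong

variable [MeasurableSpace X] [BorelSpace X] {u : X → ℝ} {g : X → ℝ≥0∞} {γ : RectCurve X}

theorem UGAlong.absolutelyContinuous (h : UGAlong u g γ) (hg : Measurable g) :
    AbsolutelyContinuousOnInterval (fun t => u (γ.toFun t)) 0 γ.len :=
  absolutelyContinuousOnInterval_of_le_lintegral (γ.aemeasurable_comp hg) h.1 h.2 γ.len_pos.le

theorem UGAlong.ae_deriv_le (h : UGAlong u g γ) (hg : Measurable g) :
    ∀ᵐ t, t ∈ Ioo 0 γ.len →
      ENNReal.ofReal |deriv (fun t => u (γ.toFun t)) t| ≤ g (γ.toFun t) :=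
  ae_ofReal_abs_deriv_le (F := fun t => u (γ.toFun t)) (γ.aemeasurable_comp hg) h.1 h.2
    γ.len_pos.le

end UGAlong

variable [MeasurableSpace X] {μ : Measure X} {A : Set X} {p : ℝ}

theorem curveModulus_mono {Γ Γ' : Set (RectCurve X)} (h : Γ ⊆ Γ') :
    curveModulus μ A p Γ ≤ curveModulus μ A p Γ' :=
  le_iInf fun ρ => le_iInf fun hρ => le_iInf fun hρ' =>
    iInf_le_of_le ρ (iInf_le_of_le hρ (iInf_le _ fun γ hγ => hρ' γ (h hγ)))

theorem curveModulus_le {Γ : Set (RectCurve X)} {ρ : X → ℝ≥0∞} (hρ : Measurable ρ)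
    (h : ∀ γ ∈ Γ, 1 ≤ γ.lineIntegral ρ) : curveModulus μ A p Γ ≤ ∫⁻ x in A, ρ x ^ p ∂μ :=
  iInf_le_of_le ρ (iInf_le_of_le hρ (iInf_le _ h))

/-- The supremum of densities admissible for the single families is admissible for the union, and
its `p`-th power is at most the sum of theirs. -/
theorem curveModulus_iUnion_eq_zero (hp : 0 < p) {Γ : ℕ → Set (RectCurve X)}
    (h : ∀ n, curveModulus μ A p (Γ n) = 0) : curveModulus μ A p (⋃ n, Γ n) = 0 := by
  refine nonpos_iff_eq_zero.1 (le_of_forall_gt fun ε hε => ?_)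
  obtain ⟨δ, hδ, hδε⟩ := ENNReal.exists_pos_sum_of_countable' hε.ne' ℕ
  have hex : ∀ n, ∃ ρ : X → ℝ≥0∞, Measurable ρ ∧ (∀ γ ∈ Γ n, 1 ≤ γ.lineIntegral ρ) ∧
      ∫⁻ x in A, ρ x ^ p ∂μ < δ n := by
    intro n
    have := (h n).trans_lt (hδ n)
    simpa only [curveModulus, iInf_lt_iff, exists_prop] using this
  choose ρ hρ hadm hlt using hex
  refine lt_of_le_of_lt ((curveModulus_le (.iSup hρ) ?_).trans ?_) hδε
  · intro γ hγ
    obtain ⟨n, hn⟩ := mem_iUnion.1 hγ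
    exact (hadm n γ hn).trans (lintegral_mono fun t => by
      simpa using le_iSup (fun n => ρ n (γ.toFun t)) n)
  · calc ∫⁻ x in A, (⨆ n, ρ n x) ^ p ∂μ ≤ ∫⁻ x in A, ∑' n, ρ n x ^ p ∂μ := by
          refine lintegral_mono fun x => ?_
          rw [← ENNReal.le_rpow_inv_iff hp]
          exact iSup_le fun n => (ENNReal.le_rpow_inv_iff hp).2
            (ENNReal.le_tsum (f := fun n => ρ n x ^ p) n)
      _ = ∑' n, ∫⁻ x in A, ρ n x ^ p ∂μ :=
          lintegral_tsum fun n => ((hρ n).pow_const p).aemeasurable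
      _ ≤ ∑' n, δ n := ENNReal.tsum_le_tsum fun n => (hlt n).le

theorem curveModulus_union_eq_zero (hp : 0 < p) {Γ Γ' : Set (RectCurve X)}
    (h : curveModulus μ A p Γ = 0) (h' : curveModulus μ A p Γ' = 0) :
    curveModulus μ A p (Γ ∪ Γ') = 0 := by
  refine nonpos_iff_eq_zero.1 ((curveModulus_mono (union_subset ?_ ?_)).trans_eq
    (curveModulus_iUnion_eq_zero hp (Γ := fun n => if n = 0 then Γ else Γ') fun n => ?_))
  · exact fun γ hγ => mem_iUnion.2 ⟨0, by simpa using hγ⟩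
  · exact fun γ hγ => mem_iUnion.2 ⟨1, by simpa using hγ⟩
  · split_ifs <;> assumption

/-- Every multiple `g / (n + 1)` is still admissible, and its energy tends to `0`. -/
theorem curveModulus_lineIntegral_eq_top (hp : 0 < p) {g : X → ℝ≥0∞} (hg : Measurable g)
    (hfin : ∫⁻ x in A, g x ^ p ∂μ < ∞) :
    curveModulus μ A p {γ | γ.lineIntegral g = ∞} = 0 := by
  refine nonpos_iff_eq_zero.1 (ge_of_tendsto' (x := atTop)
    (f := fun n : ℕ => ((n + 1 : ℕ) : ℝ≥0∞)⁻¹ ^ p * ∫⁻ x in A, g x ^ p ∂μ) ?_ fun n => ?_)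
  · have h1 : Tendsto (fun n : ℕ => ((n + 1 : ℕ) : ℝ≥0∞)⁻¹ ^ p) atTop (𝓝 (0 ^ p)) :=
      (ENNReal.continuous_rpow_const.tendsto _).comp
        (ENNReal.tendsto_inv_nat_nhds_zero.comp (tendsto_add_atTop_nat 1))
    rw [ENNReal.zero_rpow_of_pos hp] at h1
    simpa using ENNReal.Tendsto.mul_const h1 (Or.inr hfin.ne)
  · refine (curveModulus_le (ρ := fun x => ((n + 1 : ℕ) : ℝ≥0∞)⁻¹ * g x)
      (hg.const_mul _) fun γ hγ => ?_).trans_eq ?_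
    · rw [RectCurve.lineIntegral, lintegral_const_mul' _ _ (by simp)]
      have : ∫⁻ t in Icc 0 γ.len, g (γ.toFun t) = ∞ := hγ
      rw [this, ENNReal.mul_top (by simp)]
      exact le_top
    · simp_rw [ENNReal.mul_rpow_of_nonneg _ _ hp.le]
      exact lintegral_const_mul _ (hg.pow_const p)

/-- A density admissible for the subcurves is admissible for the longer curves containing them. -/
theorem curveModulus_exists_sub_eq_zero {Γ : Set (RectCurve X)} (h : curveModulus μ A p Γ = 0) :
    curveModulus μ A p {γ | ∃ (a b : ℝ) (ha : 0 ≤ a) (hab : a < b) (hb : b ≤ γ.len),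
      γ.sub ha hab hb ∈ Γ} = 0 := by
  refine nonpos_iff_eq_zero.1 (le_trans ?_ h.le)
  refine le_iInf fun ρ => le_iInf fun hρ => le_iInf fun hadm => curveModulus_le hρ ?_
  rintro γ ⟨a, b, ha, hab, hb, hγ⟩
  refine (hadm _ hγ).trans ?_
  rw [γ.lineIntegral_sub]
  exact lintegral_mono_set (Icc_subset_Icc ha hb)

/-- A bad curve either has infinite line integral or contains a subcurve violating the inequality;
both families are null. -/
theorem IsWeakUpperGradientOn.curveModulus_not_ugAlong (hp : 0 < p) {u : X → ℝ} {g : X → ℝ≥0∞}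
    (h : IsWeakUpperGradientOn μ A p u g) (hfin : ∫⁻ x in A, g x ^ p ∂μ < ∞) :
    curveModulus μ A p {γ | γ.InSet A ∧ ¬ UGAlong u g γ} = 0 := by
  refine nonpos_iff_eq_zero.1 ((curveModulus_mono ?_).trans_eq (curveModulus_union_eq_zero hp
    (curveModulus_lineIntegral_eq_top hp h.1 hfin) (curveModulus_exists_sub_eq_zero h.2)))
  rintro γ ⟨hγA, hγ⟩
  by_contra hcon
  simp only [mem_union, not_or, mem_ofPred_eq, not_exists, not_and, not_not] at hcon
  refine hγ ⟨hcon.1, fun a b ha hab hb => ?_⟩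
  have := hcon.2 a b ha hab hb (hγA.sub ha hab hb)
  rw [UGInequality, γ.lineIntegral_sub] at this
  simpa [RectCurve.sub] using this

theorem codimHausdorff_mono (μ : Measure X) {A B : Set X} (h : A ⊆ B) :
    codimHausdorff μ A ≤ codimHausdorff μ B :=
  iSup_mono fun _ => iSup_mono fun _ => iInf_mono fun _ => iInf_mono fun _ => iInf_mono fun _ =>
    le_iInf fun hB => iInf_le _ (h.trans hB)

theorem IsUpperGradientOn.add_mul_lipschitz {u φ : X → ℝ} {K : ℝ≥0} {g : X → ℝ≥0∞}
    (hg : IsUpperGradientOn A u g)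
    (hφ : LipschitzWith K φ) (τ : ℝ) :
    IsUpperGradientOn A (fun y => u y + τ * φ y) fun y => g y + ENNReal.ofReal (|τ| * K) := by
  refine ⟨hg.1.add_const _, fun γ hγ => ?_⟩
  have h1 := hg.2 γ hγ
  rw [UGInequality, RectCurve.lineIntegral] at h1 ⊢
  rw [lintegral_add_right _ measurable_const, setLIntegral_const, Real.volume_Icc, sub_zero,
    ← ENNReal.ofReal_mul (by positivity)]
  refine le_trans ?_ (add_le_add h1 le_rfl)
  rw [← ENNReal.ofReal_add (abs_nonneg _) (by have := γ.len_pos; positivity)]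
  refine ENNReal.ofReal_le_ofReal ?_
  calc |u (γ.toFun γ.len) + τ * φ (γ.toFun γ.len) - (u (γ.toFun 0) + τ * φ (γ.toFun 0))|
      = |(u (γ.toFun γ.len) - u (γ.toFun 0)) + τ * (φ (γ.toFun γ.len) - φ (γ.toFun 0))| := by
        congr 1; ring
    _ ≤ |u (γ.toFun γ.len) - u (γ.toFun 0)| + |τ| * |φ (γ.toFun γ.len) - φ (γ.toFun 0)| := by
        rw [← abs_mul]; exact abs_add_le _ _
    _ ≤ _ := by
        rw [mul_assoc]
        gcongr
        exact γ.abs_sub_le_mul_len hφ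

end Curves

/-! ### Minimal weak upper gradients -/

section Minimal

variable {X : Type*} [MetricSpace X] [MeasurableSpace X] [BorelSpace X] {μ : Measure X}
  {A : Set X} {p : ℝ} {u : X → ℝ}

theorem IsWeakUpperGradientOn.iInf (hp : 0 < p) {g : ℕ → X → ℝ≥0∞}
    (h : ∀ n, IsWeakUpperGradientOn μ A p u (g n)) (hfin : ∀ n, ∫⁻ x in A, g n x ^ p ∂μ < ∞) :
    IsWeakUpperGradientOn μ A p u fun x => ⨅ n, g n x := by
  refine ⟨.iInf fun n => (h n).1, nonpos_iff_eq_zero.1 ((curveModulus_mono ?_).trans_eq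
    (curveModulus_iUnion_eq_zero hp fun n => (h n).curveModulus_not_ugAlong hp (hfin n)))⟩
  rintro γ ⟨hγA, hγ⟩
  by_contra hcon
  have hug : ∀ n, UGAlong u (g n) γ := fun n => by
    by_contra hn
    exact hcon (mem_iUnion.2 ⟨n, hγA, hn⟩)
  refine hγ (ofReal_abs_sub_le_lintegral_of_deriv_le (F := fun t => u (γ.toFun t)) γ.len_pos.le
    ((hug 0).absolutelyContinuous (h 0).1) ?_)
  filter_upwards [ae_all_iff.2 fun n => (hug n).ae_deriv_le (h n).1] with t ht hmem
  exact le_iInf fun n => ht n hmem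

/-- The infimum `G` of an energy-minimizing sequence has least energy. Its minimum with any
competitor cannot have less, so it equals `G` a.e. -/
theorem exists_isMinimalWeakUpperGradientOn (hp : 0 < p) {h₀ : X → ℝ≥0∞}
    (h : IsWeakUpperGradientOn μ A p u h₀) (hfin : ∫⁻ x in A, h₀ x ^ p ∂μ < ∞) :
    ∃ g, IsMinimalWeakUpperGradientOn μ A p u g := by
  set S : Set ℝ≥0∞ := {e | ∃ g : X → ℝ≥0∞, IsWeakUpperGradientOn μ A p u g ∧
    ∫⁻ x in A, g x ^ p ∂μ < ∞ ∧ ∫⁻ x in A, g x ^ p ∂μ = e} with hS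
  obtain ⟨e, -, he, heS⟩ := exists_seq_tendsto_sInf (S := S) ⟨_, h₀, h, hfin, rfl⟩
    (OrderBot.bddBelow S)
  choose g hg hgfin hge using heS
  have hG := IsWeakUpperGradientOn.iInf hp hg hgfin
  have hGle : ∀ n, ∫⁻ x in A, (⨅ n, g n x) ^ p ∂μ ≤ ∫⁻ x in A, g n x ^ p ∂μ := fun n =>
    lintegral_mono fun x => ENNReal.rpow_le_rpow (iInf_le _ n) hp.le
  have hGfin := (hGle 0).trans_lt (hgfin 0)
  have hGinf : ∫⁻ x in A, (⨅ n, g n x) ^ p ∂μ ≤ sInf S :=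
    ge_of_tendsto' he fun n => (hGle n).trans_eq (hge n)
  refine ⟨fun x => ⨅ n, g n x, hG, hGfin, fun k hk hkfin => ?_⟩
  set G := fun x => ⨅ n, g n x
  -- The two functions `G` and `k` as a sequence, so that the countable infimum lemma gives their
  -- minimum.
  set m : ℕ → X → ℝ≥0∞ := fun n => if n = 0 then G else k with hm
  have hmG : (fun x => ⨅ n, m n x) ≤ G := fun x => iInf_le (fun n => m n x) 0
  have hmk : (fun x => ⨅ n, m n x) ≤ k := fun x => iInf_le (fun n => m n x) 1
  have hM : IsWeakUpperGradientOn μ A p u fun x => ⨅ n, m n x := by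
    refine IsWeakUpperGradientOn.iInf hp (fun n => ?_) fun n => ?_ <;> simp only [hm] <;>
      split_ifs <;> assumption
  have hMle : ∀ x, (⨅ n, m n x) ^ p ≤ G x ^ p := fun x => ENNReal.rpow_le_rpow (hmG x) hp.le
  have hMfin : ∫⁻ x in A, (⨅ n, m n x) ^ p ∂μ < ∞ := (lintegral_mono hMle).trans_lt hGfin
  have hMS : ∫⁻ x in A, (⨅ n, m n x) ^ p ∂μ ∈ S := ⟨_, hM, hMfin, rfl⟩
  have hae := ae_eq_of_ae_le_of_lintegral_le (ae_of_all (μ.restrict A) hMle) hMfin.ne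
    (hG.1.pow_const p).aemeasurable (hGinf.trans (sInf_le hMS))
  filter_upwards [hae] with x hx
  refine le_trans (le_of_eq ?_) (hmk x)
  exact (ENNReal.rpow_left_injective hp.ne' hx).symm

end Minimal

/-! ### Perturbations of functions that are constant on a ball -/

section Perturbation

variable {X : Type*} [MetricSpace X] [MeasurableSpace X] [BorelSpace X] {μ : Measure X}
  {A : Set X} {p : ℝ} {u φ : X → ℝ} {K : ℝ≥0}

/-- Membership needs only the crude upper gradient `g + |τ| * K`; the energy estimate needs the
sharper one below. -/
theorem MemNewtonian.add_mul_lipschitz (hp : 1 ≤ p) (hA : μ A ≠ ∞) (hu : MemNewtonian μ A p u)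
    (hφ : LipschitzWith K φ) {M : ℝ} (hM : ∀ y, |φ y| ≤ M) (τ : ℝ) :
    MemNewtonian μ A p fun y => u y + τ * φ y := by
  obtain ⟨hL, g, hg, hfin⟩ := hu
  have : IsFiniteMeasure (μ.restrict A) := ⟨by simpa using hA.lt_top⟩
  refine ⟨hL.add (MemLp.of_bound (hφ.continuous.measurable.const_mul τ).aestronglyMeasurable
    (|τ| * M) (ae_of_all _ fun y => ?_)), _, hg.add_mul_lipschitz hφ τ, ?_⟩
  · rw [Real.norm_eq_abs, abs_mul]
    exact mul_le_mul_of_nonneg_left (hM y) (abs_nonneg _)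
  · refine ENNReal.lintegral_rpow_add_lt_top_of_lintegral_rpow_lt_top hg.1.aemeasurable hfin ?_ hp
    rw [lintegral_const]
    exact ENNReal.mul_lt_top (ENNReal.rpow_lt_top_of_nonneg (by linarith) ENNReal.ofReal_ne_top)
      (measure_lt_top _ _)

open scoped Classical in
-- Replacing `g` on the ball, instead of adding to it, avoids a term of first order in `|τ|` in the
-- energy.
theorem IsWeakUpperGradientOn.add_mul_of_eqOn_ball (hp : 0 < p) {g : X → ℝ≥0∞}
    (hg : IsWeakUpperGradientOn μ A p u g) (hfin : ∫⁻ x in A, g x ^ p ∂μ < ∞)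
    {x : X} {r s : ℝ} (hsr : s < r) {c : ℝ} (hc : ∀ y ∈ ball x r ∩ A, u y = c)
    (hφ : LipschitzWith K φ) (hφs : ∀ y ∉ closedBall x s, φ y = 0) (τ : ℝ) :
    IsWeakUpperGradientOn μ A p (fun y => u y + τ * φ y)
      ((ball x r).piecewise (fun _ => ENNReal.ofReal (|τ| * K)) g) := by
  refine ⟨measurable_const.piecewise measurableSet_ball hg.1, nonpos_iff_eq_zero.1
    ((curveModulus_mono ?_).trans_eq (hg.curveModulus_not_ugAlong hp hfin))⟩
  rintro γ ⟨hγA, hγ⟩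
  refine ⟨hγA, fun hug => hγ ?_⟩
  have hlip : LipschitzOnWith K (fun t => φ (γ.toFun t)) (Icc 0 γ.len) := by
    have h := hφ.comp_lipschitzOnWith γ.lipschitzOnWith
    rwa [mul_one] at h
  have hcont := γ.lipschitzOnWith.continuousOn
  have hAC : AbsolutelyContinuousOnInterval (fun t => τ * φ (γ.toFun t)) 0 γ.len := by
    refine AbsolutelyContinuousOnInterval.const_mul τ
      (LipschitzOnWith.absolutelyContinuousOnInterval (K := K) ?_)
    rwa [uIcc_of_le γ.len_pos.le]
  refine ofReal_abs_sub_le_lintegral_of_deriv_le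
    (F := fun t => u (γ.toFun t) + τ * φ (γ.toFun t)) γ.len_pos.le
    ((hug.absolutelyContinuous hg.1).fun_add hAC) ?_
  filter_upwards [hug.ae_deriv_le hg.1] with t ht hmem
  have hnhds : Icc 0 γ.len ∈ 𝓝 t := Icc_mem_nhds hmem.1 hmem.2
  have hcat : ContinuousAt γ.toFun t := hcont.continuousAt hnhds
  -- Inside the open ball `u ∘ γ` is locally constant, so only `φ` contributes. Outside it, `s < r`
  -- leaves a neighbourhood where `φ` vanishes, so only `u` contributes.
  by_cases hb : γ.toFun t ∈ ball x r
  · rw [piecewise_eq_of_mem _ _ _ hb]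
    refine ENNReal.ofReal_le_ofReal ?_
    rw [← Real.norm_eq_abs]
    refine norm_deriv_le_of_lip' (by positivity) ?_
    filter_upwards [hnhds, hcat.preimage_mem_nhds (isOpen_ball.mem_nhds hb)] with y hy hyb
    rw [hc _ ⟨hb, hγA t (mem_of_mem_nhds hnhds)⟩, hc _ ⟨hyb, hγA y hy⟩, add_sub_add_left_eq_sub,
      ← mul_sub, norm_mul, Real.norm_eq_abs τ, mul_assoc]
    gcongr
    simpa [dist_eq_norm] using hlip.dist_le_mul y hy t (mem_of_mem_nhds hnhds)
  · rw [piecewise_eq_of_notMem _ _ _ hb]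
    have hmem' : γ.toFun t ∈ (closedBall x s)ᶜ := fun h => hb (closedBall_subset_ball hsr h)
    have hev : (fun t => u (γ.toFun t) + τ * φ (γ.toFun t)) =ᶠ[𝓝 t] fun t => u (γ.toFun t) := by
      filter_upwards [hcat.preimage_mem_nhds (isClosed_closedBall.isOpen_compl.mem_nhds hmem')]
        with y hy
      rw [hφs _ hy, mul_zero, add_zero]
    rw [hev.deriv_eq]
    exact ht hmem

/-- On a ball of radius `r` the function `τ * φ` deviates from its central value by at most `|τ| * K
* r`, so the exceptional set does not grow. -/
theorem IsTrace.add_mul_lipschitz {Tu : X → ℝ} (h : IsTrace μ A u Tu) (hA : MeasurableSet A)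
    (hφ : LipschitzWith K φ) (τ : ℝ) :
    IsTrace μ A (fun y => u y + τ * φ y) fun y => Tu y + τ * φ y := by
  refine nonpos_iff_eq_zero.1 ((codimHausdorff_mono μ ?_).trans_eq h)
  rintro x ⟨hx, hnot⟩
  refine ⟨hx, fun hlim => hnot ?_⟩
  have hlim2 : Tendsto (fun r : ℝ => ENNReal.ofReal (|τ| * (K * r))) (𝓝[>] 0) (𝓝 0) := by
    have : Tendsto (fun r : ℝ => ENNReal.ofReal (|τ| * (K * r))) (𝓝 0)
        (𝓝 (ENNReal.ofReal (|τ| * (K * 0)))) :=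
      (ENNReal.continuous_ofReal.comp (by fun_prop)).tendsto 0
    simpa using this.mono_left nhdsWithin_le_nhds
  have hsum := hlim.add hlim2
  rw [add_zero] at hsum
  refine tendsto_of_tendsto_of_tendsto_of_le_of_le' tendsto_const_nhds hsum
    (Eventually.of_forall fun _ => zero_le) ?_
  filter_upwards [self_mem_nhdsWithin] with r hr
  set ν := μ.restrict (ball x r ∩ A)
  have hae : ∀ᵐ y ∂((ν univ)⁻¹ • ν), y ∈ ball x r ∩ A :=
    Measure.ae_smul_measure (ae_restrict_mem (measurableSet_ball.inter hA)) _
  calc ⨍⁻ y in ball x r ∩ A, ENNReal.ofReal |u y + τ * φ y - (Tu x + τ * φ x)| ∂μ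
      ≤ ⨍⁻ y in ball x r ∩ A, (ENNReal.ofReal |u y - Tu x| + ENNReal.ofReal (|τ| * (K * r))) ∂μ := by
        refine lintegral_mono_ae ?_
        filter_upwards [hae] with y hy
        rw [← ENNReal.ofReal_add (abs_nonneg _) (by have : 0 < r := hr; positivity)]
        refine ENNReal.ofReal_le_ofReal ?_
        have h1 : |φ y - φ x| ≤ K * r := by
          refine (hφ.dist_le_mul y x).trans ?_
          gcongr
          exact (mem_ball.1 hy.1).le
        calc |u y + τ * φ y - (Tu x + τ * φ x)| = |(u y - Tu x) + τ * (φ y - φ x)| := by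
              congr 1; ring
          _ ≤ |u y - Tu x| + |τ| * |φ y - φ x| := by rw [← abs_mul]; exact abs_add_le _ _
          _ ≤ _ := by gcongr
    _ = ⨍⁻ y in ball x r ∩ A, ENNReal.ofReal |u y - Tu x| ∂μ +
        ⨍⁻ _ in ball x r ∩ A, ENNReal.ofReal (|τ| * (K * r)) ∂μ :=
        lintegral_add_right _ measurable_const
    _ ≤ _ := by
        gcongr
        -- The averaging measure has total mass at most `1`, even if the set is null or of infinite
        -- measure.
        rw [laverage, lintegral_const]
        refine (mul_le_mul_right ?_ _).trans_eq (mul_one _)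
        rw [Measure.smul_apply, smul_eq_mul]
        exact ENNReal.inv_mul_le_one _

end Perturbation

/-! ### The perimeter measure lives on the boundary -/

section Perimeter

variable {X : Type*} [MetricSpace X] [MeasurableSpace X] {μ : Measure X} {E : Set X}

theorem IsDoublingMeasure.measure_ball_pos (h : IsDoublingMeasure μ) (x : X) {r : ℝ}
    (hr : 0 < r) : 0 < μ (ball x r) := by
  obtain ⟨C, hC⟩ := h
  simpa [mul_div_cancel₀] using (hC x (r / 2) (half_pos hr)).1

theorem IsDoublingMeasure.measure_lt_top (h : IsDoublingMeasure μ) (hE : Bornology.IsBounded E) :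
    μ E < ∞ := by
  rcases E.eq_empty_or_nonempty with rfl | ⟨x, -⟩
  · simp
  · obtain ⟨C, hC⟩ := h
    obtain ⟨r, hr, hsub⟩ := hE.subset_ball_lt 0 x
    exact (measure_mono hsub).trans_lt (hC x r hr).2.2

/-- The constant sequence `a` with zero gradients is admissible; the alternative in `ha` is what
puts `a` in `L^1(U)`. -/
theorem perimeterOn_eq_zero_of_eqOn_const {U : Set X} (hU : MeasurableSet U) (a : ℝ)
    (ha : a = 0 ∨ μ U ≠ ∞) (h : ∀ x ∈ U, E.indicator (fun _ => (1 : ℝ)) x = a) :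
    perimeterOn μ E U = 0 := by
  have hug : IsUpperGradientOn U (fun _ => a) (fun _ => 0) :=
    ⟨measurable_const, fun γ _ => by simp [UGInequality]⟩
  have hL : MemLp (fun _ : X => a) (ENNReal.ofReal 1) (μ.restrict U) := by
    rcases ha with rfl | ha
    · exact MemLp.zero'
    · have : IsFiniteMeasure (μ.restrict U) := ⟨by simpa using ha.lt_top⟩
      exact memLp_const a
  have hseq : IsPerimeterSeq μ E U (fun _ _ => a) (fun _ _ => 0) := by
    refine ⟨fun _ => ⟨hL, _, hug, by simp⟩, fun _ => hug, ?_⟩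
    have h0 : ∫⁻ x in U, ENNReal.ofReal |a - E.indicator (fun _ => (1 : ℝ)) x| ∂μ = 0 := by
      rw [setLIntegral_congr_fun (g := fun _ => 0) hU fun x hx => by simp [h x hx]]
      simp
    simpa only [h0] using tendsto_const_nhds
  exact nonpos_iff_eq_zero.1 ((perimeterOn_le hseq).trans_eq (by simp))

variable [BorelSpace X]

theorem perimeterMeasure_le_perimeterOn {U : Set X} (hU : IsOpen U) :
    perimeterMeasure μ E U ≤ perimeterOn μ E U := by
  rw [perimeterMeasure, toMeasure_apply _ _ hU.measurableSet]
  exact (OuterMeasure.ofFunction_le (m_empty := extend_empty isOpen_empty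
    (perimeterOn_empty μ E)) U).trans_eq (extend_eq _ hU)

theorem HasFinitePerimeter.isFiniteMeasure (h : HasFinitePerimeter μ E) :
    IsFiniteMeasure (perimeterMeasure μ E) :=
  ⟨(perimeterMeasure_le_perimeterOn isOpen_univ).trans_lt h.2⟩

/-- The characteristic function is constant on the open sets `E` and `(closure E)ᶜ`, which cover the
complement of the frontier. -/
theorem perimeterMeasure_compl_frontier (hE : IsOpen E) (hfin : μ E ≠ ∞) :
    perimeterMeasure μ E (frontier E)ᶜ = 0 := by
  have hsub : (frontier E)ᶜ ⊆ E ∪ (closure E)ᶜ := by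
    intro x hx
    by_contra hcon
    simp only [mem_union, mem_compl_iff, not_or, not_not] at hcon
    exact hx (by rw [hE.frontier_eq]; exact ⟨hcon.2, hcon.1⟩)
  have ho : IsOpen (closure E)ᶜ := isClosed_closure.isOpen_compl
  refine measure_mono_null hsub (measure_union_null ?_ ?_)
  · exact nonpos_iff_eq_zero.1 ((perimeterMeasure_le_perimeterOn hE).trans_eq
      (perimeterOn_eq_zero_of_eqOn_const hE.measurableSet 1 (.inr hfin) fun x hx => by simp [hx]))
  · exact nonpos_iff_eq_zero.1 ((perimeterMeasure_le_perimeterOn ho).trans_eq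
      (perimeterOn_eq_zero_of_eqOn_const ho.measurableSet 0 (.inl rfl) fun x hx =>
        indicator_of_notMem (fun h => hx (subset_closure h)) _))

end Perimeter

/-! ### The Euler-Lagrange equation for test functions supported where `u` is constant -/

theorem eq_zero_of_forall_le_rpow_add_mul {p K a : ℝ} (hp : 1 < p)
    (h : ∀ τ : ℝ, 0 ≤ |τ| ^ p * K + τ * a) : a = 0 := by
  have hlim : Tendsto (fun s : ℝ => s ^ (p - 1) * (|a| ^ p * K)) (𝓝[>] 0) (𝓝 0) := by
    have h1 := (Real.continuous_rpow_const (sub_pos.2 hp).le).tendsto (0 : ℝ)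
    rw [Real.zero_rpow (sub_pos.2 hp).ne'] at h1
    simpa using (h1.mono_left nhdsWithin_le_nhds).mul_const (|a| ^ p * K)
  have hle : a ^ 2 ≤ 0 := by
    refine ge_of_tendsto hlim ?_
    filter_upwards [self_mem_nhdsWithin] with s hs
    have hs : 0 < s := hs
    -- With `τ = -s * a` the hypothesis reads `s * a ^ 2 ≤ s ^ p * |a| ^ p * K`; divide by `s` and
    -- let `s → 0⁺`.
    have := h (-(s * a))
    rw [abs_neg, abs_mul, abs_of_pos hs, Real.mul_rpow hs.le (abs_nonneg a),
      show s ^ p = s ^ (p - 1) * s by rw [← Real.rpow_add_one hs.ne']; ring_nf] at this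
    nlinarith [mul_pos hs hs]
  exact pow_eq_zero_iff two_ne_zero |>.1 (le_antisymm hle (sq_nonneg a))

section EulerLagrange

variable {X : Type*} [MetricSpace X] [MeasurableSpace X] [BorelSpace X] {μ : Measure X}
  {Ω : Set X} {p : ℝ} {f u φ : X → ℝ} {K : ℝ≥0}

theorem IsNeumannData.integrableOn_mul [IsFiniteMeasure (perimeterMeasure μ Ω)]
    (hf : IsNeumannData μ Ω f) (hφ : Measurable φ) {M : ℝ} (hM : ∀ y, |φ y| ≤ M) :
    IntegrableOn (fun y => φ y * f y) (frontier Ω) (perimeterMeasure μ Ω) := by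
  obtain ⟨N, hN⟩ := hf.bounded
  refine Integrable.of_bound (hφ.aemeasurable.mul hf.aemeasurable).aestronglyMeasurable (M * N)
    ((ae_restrict_mem isClosed_frontier.measurableSet).mono fun y hy => ?_)
  rw [Real.norm_eq_abs, abs_mul]
  exact mul_le_mul (hM y) (hN y hy) (abs_nonneg _) ((abs_nonneg _).trans (hM y))

theorem IsNeumannSolution.setIntegral_mul_eq_zero [IsFiniteMeasure (perimeterMeasure μ Ω)]
    (hp : 1 < p) (hΩ : IsOpen Ω) (hfin : μ Ω ≠ ∞) (hu : IsNeumannSolution μ p Ω f u) {x : X}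
    {r s : ℝ} (hsr : s < r) {c : ℝ} (hc : ∀ y ∈ ball x r ∩ Ω, u y = c) (hφ : LipschitzWith K φ)
    {M : ℝ} (hM : ∀ y, |φ y| ≤ M) (hφs : ∀ y ∉ closedBall x s, φ y = 0) :
    ∫ y in frontier Ω, φ y * f y ∂(perimeterMeasure μ Ω) = 0 := by
  classical
  obtain ⟨hf, hN, e, ⟨g, Tu, hmin, htr, hint, rfl⟩, hle⟩ := hu
  have hp0 : 0 < p := one_pos.trans hp
  have hφf := hf.integrableOn_mul (φ := φ) hφ.continuous.measurable hM
  refine eq_zero_of_forall_le_rpow_add_mul (K := (K : ℝ) ^ p * (μ Ω).toReal) hp fun τ => ?_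
  have hh := hmin.1.add_mul_of_eqOn_ball hp0 hmin.2.1 hsr hc hφ hφs τ
  set h := (ball x r).piecewise (fun _ => ENNReal.ofReal (|τ| * K)) g
  -- At each point `h` is one of the two gradients, so no cross terms appear.
  have hhle : ∫⁻ y in Ω, h y ^ p ∂μ ≤
      ∫⁻ y in Ω, g y ^ p ∂μ + ENNReal.ofReal (|τ| * K) ^ p * μ Ω := by
    rw [← setLIntegral_const, ← lintegral_add_right _ measurable_const]
    refine lintegral_mono fun y => ?_
    by_cases hy : y ∈ ball x r
    · simp only [h, piecewise_eq_of_mem _ _ _ hy]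
      exact le_add_self
    · simp only [h, piecewise_eq_of_notMem _ _ _ hy]
      exact le_self_add
  have hcfin : ENNReal.ofReal (|τ| * K) ^ p * μ Ω ≠ ∞ :=
    ENNReal.mul_ne_top (ENNReal.rpow_ne_top_of_nonneg hp0.le ENNReal.ofReal_ne_top) hfin
  have hhfin : ∫⁻ y in Ω, h y ^ p ∂μ < ∞ :=
    hhle.trans_lt (ENNReal.add_lt_top.2 ⟨hmin.2.1, hcfin.lt_top⟩)
  obtain ⟨g', hg'⟩ := exists_isMinimalWeakUpperGradientOn hp0 hh hhfin
  have hg'le : ∫⁻ y in Ω, g' y ^ p ∂μ ≤ ∫⁻ y in Ω, h y ^ p ∂μ :=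
    lintegral_mono_ae ((hg'.2.2 h hh hhfin).mono fun y hy => ENNReal.rpow_le_rpow hy hp0.le)
  have hreal : (∫⁻ y in Ω, g' y ^ p ∂μ).toReal ≤
      (∫⁻ y in Ω, g y ^ p ∂μ).toReal + |τ| ^ p * ((K : ℝ) ^ p * (μ Ω).toReal) := by
    refine (ENNReal.toReal_mono (ENNReal.add_ne_top.2 ⟨hmin.2.1.ne, hcfin⟩)
      (hg'le.trans hhle)).trans_eq ?_
    rw [ENNReal.toReal_add hmin.2.1.ne hcfin, ENNReal.toReal_mul, ← ENNReal.toReal_rpow,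
      ENNReal.toReal_ofReal (by positivity), Real.mul_rpow (abs_nonneg τ) K.coe_nonneg, mul_assoc]
  have heq : (fun y => (Tu y + τ * φ y) * f y) = fun y => Tu y * f y + τ * (φ y * f y) := by
    ext y; ring
  have hfun := hle _ (hN.add_mul_lipschitz hp.le hfin hφ hM τ) _
    ⟨g', _, hg', htr.add_mul_lipschitz hΩ.measurableSet hφ τ,
      heq ▸ hint.add (hφf.const_mul τ), rfl⟩
  rw [heq, integral_add hint (hφf.const_mul τ), integral_const_mul] at hfun
  linarith

theorem IsNeumannSolution.eq_zero_of_eqOn_ball (hμ : IsDoublingMeasure μ) (hp : 1 < p)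
    (hΩ : IsAdmissibleDomain μ p Ω) (hf : ContinuousOn f (frontier Ω))
    (hu : IsNeumannSolution μ p Ω f u) {y : X} (hy : y ∈ frontier Ω) {r : ℝ} (hr : 0 < r) {c : ℝ}
    (hc : ∀ z ∈ ball y r ∩ Ω, u z = c) : f y = 0 := by
  have : IsFiniteMeasure (perimeterMeasure μ Ω) := hΩ.finitePerimeter.isFiniteMeasure
  have hfin : μ Ω ≠ ∞ := (hμ.measure_lt_top hΩ.isBounded).ne
  by_contra hne
  -- The regularity bound covers only radii up to `diam Ω`. With zero diameter `Ω` would be open and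
  -- closed, leaving no boundary point `y`.
  have hdiam : 0 < diam Ω := by
    refine diam_nonneg.lt_of_ne fun h0 => ?_
    have hsub : Ω.Subsingleton := fun a ha b hb =>
      dist_le_zero.1 (h0 ▸ dist_le_diam_of_mem hΩ.isBounded ha hb)
    rw [hΩ.isOpen.frontier_eq, hsub.isClosed.closure_eq, sdiff_self] at hy
    exact hy
  have hev : ∀ᶠ z in 𝓝[frontier Ω] y, 0 < f z * f y :=
    ((hf y hy).mul_const (f y)).eventually (lt_mem_nhds (mul_self_pos.2 hne))
  obtain ⟨δ, hδ, hδf⟩ := Metric.mem_nhdsWithin_iff.1 hev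
  obtain ⟨s, hs, hsm⟩ := exists_between (lt_min (lt_min hδ hr) hdiam)
  obtain ⟨⟨hsδ, hsr⟩, hsd⟩ := by simpa only [lt_min_iff] using hsm
  set φ : X → ℝ := fun z => max 0 (s - dist z y) with hφdef
  have hφ0 : ∀ z, 0 ≤ φ z := fun z => le_max_left _ _
  have hφs : ∀ z, s ≤ dist z y → φ z = 0 := fun z hz => max_eq_left (by linarith)
  have hφpos : ∀ z ∈ ball y s, 0 < φ z := fun z hz =>
    lt_max_of_lt_right (sub_pos.2 (mem_ball.1 hz))
  have hφL : LipschitzWith 1 φ := by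
    refine LipschitzWith.const_max (LipschitzWith.of_dist_le_mul fun a b => ?_) 0
    rw [dist_sub_left]
    exact (LipschitzWith.dist_left y).dist_le_mul a b
  have hφM : ∀ z, |φ z| ≤ s := fun z => by
    rw [abs_of_nonneg (hφ0 z)]
    exact max_le hs.le (by linarith [dist_nonneg (x := z) (y := y)])
  have hzero := hu.setIntegral_mul_eq_zero hp hΩ.isOpen hfin hsr hc hφL hφM
    fun z hz => hφs z (not_le.1 hz).le
  -- The factor `f y` makes the integrand nonnegative whatever the sign of `f y`.
  have hzero' : ∫ z in frontier Ω, φ z * f z * f y ∂(perimeterMeasure μ Ω) = 0 := by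
    rw [integral_mul_const, hzero, zero_mul]
  have hnn : ∀ z ∈ frontier Ω, 0 ≤ φ z * f z * f y := fun z hz => by
    by_cases hzs : z ∈ ball y s
    · rw [mul_assoc]
      exact mul_nonneg (hφ0 z) (hδf ⟨ball_subset_ball hsδ.le hzs, hz⟩).le
    · rw [hφs z (not_lt.1 hzs), zero_mul, zero_mul]
  have hfm : MeasurableSet (frontier Ω) := isClosed_frontier.measurableSet
  rw [setIntegral_eq_zero_iff_of_nonneg_ae (ae_restrict_of_forall_mem hfm hnn)
    ((hu.1.integrableOn_mul hφL.continuous.measurable hφM).mul_const _),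
    Filter.EventuallyEq, ae_restrict_iff' hfm] at hzero'
  have hnull : perimeterMeasure μ Ω (ball y s) = 0 := by
    have h1 : ∀ᵐ z ∂(perimeterMeasure μ Ω), z ∈ frontier Ω :=
      perimeterMeasure_compl_frontier hΩ.isOpen hfin
    refine measure_eq_zero_iff_ae_notMem.2 ?_
    filter_upwards [h1, hzero'] with z hzΩ hz0 hz
    have h2 := hz0 hzΩ
    rw [mul_assoc] at h2
    exact (mul_pos (hφpos z hz) (hδf ⟨ball_subset_ball hsδ.le hz, hzΩ⟩)).ne' h2
  obtain ⟨C, hC⟩ := hΩ.boundary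
  have h3 := (hC y hy s hs hsd.le).1
  rw [hnull, mul_zero, nonpos_iff_eq_zero, ENNReal.div_eq_zero_iff] at h3
  exact h3.elim (hμ.measure_ball_pos y hs).ne' ENNReal.ofReal_ne_top

end EulerLagrange

end NeumannMetric

end

theorem proposition6p3 {X : Type*} [MetricSpace X] [CompleteSpace X] [MeasurableSpace X]
    [BorelSpace X] (μ : Measure X) (hμ : IsDoublingMeasure μ) (p : ℝ) (hp : 1 < p)
    (hX : SupportsPoincare μ univ p) (Ω : Set X) (hΩ : IsAdmissibleDomain μ p Ω)
    (f u : X → ℝ) (hf : ContinuousOn f (frontier Ω)) (hu : IsNeumannSolution μ p Ω f u) :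
    (∀ x ∈ frontier Ω, ∀ r : ℝ, 0 < r → (∃ c : ℝ, ∀ y ∈ ball x r ∩ Ω, u y = c) →
      ∀ y ∈ ball x (r / 2) ∩ frontier Ω, f y = 0) ∧
    ((∃ y ∈ frontier Ω, f y ≠ 0) → ¬ ∃ c : ℝ, ∀ y ∈ Ω, u y = c) := by
  constructor
  · rintro x - r hr ⟨c, hc⟩ y ⟨hyx, hy⟩
    -- Recentre at `y`: the ball of radius `r / 2` about `y` lies in `ball x r`.
    refine hu.eq_zero_of_eqOn_ball hμ hp hΩ hf hy (half_pos hr) (c := c) fun z hz => hc z ⟨?_, hz.2⟩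
    have h1 := mem_ball.1 hz.1
    have h2 := mem_ball.1 hyx
    exact mem_ball.2 ((dist_triangle z y x).trans_lt (by linarith))
  · rintro ⟨y, hy, hne⟩ ⟨c, hc⟩
    exact hne (hu.eq_zero_of_eqOn_ball hμ hp hΩ hf hy one_pos fun z hz => hc z hz.2)
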